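/- Let $B$ be a stable $C^*$-algebra (i.e. $B\cong B\otimes K$, where $K$ is the algebra of compact operators on a separable infinite-dimensional Hilbert space) whose multiplier algebra $M(B)$ has real rank zero. Let $X$ be $[0,1]$, $[0,\infty)$, $(-\infty,\infty)$ or the circle $\mathbb{T}=[0,1]/\{0,1\}$. Let $I=C(X)\otimes B$ (the norm continuous functions $X\to B$) if $X$ is compact and $I=C_0(X)\otimes B$ (the norm continuous functions $X\to B$ vanishing at infinity) otherwise. Identify $M(I)$ with the algebra $C_b(X,M(B)_s)$ of bounded functions $X\to M(B)$ that are continuous for the strict topology of $M(B)$, and let $\pi\colon M(I)\to M(I)/I$ be the quotient map. Then for every projection $\mathbf f\in M(I)/I$ there are an integer $n\ge 0$, points $x_1<\dots<x_n$ in the interior of $X$ (in $(0,1)$ if $X=\mathbb{T}$) dividing $X$ (respectively $[0,1]$ if $X=\mathbb{T}$) into $n+1$ closed subintervals $X_0,\dots,X_n$, numbered from left to right, and functions $f_i\in C_b(X_i,M(B)_s)$, $0\le i\le n$, such that 1. $f_i(t)$ is a projection in $M(B)$ for every $i$ and every $t\in X_i$; 2. $f_i(x_i)-f_{i-1}(x_i)\in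 B$ for $i=1,\dots,n$, and, if $X=\mathbb{T}$, also $f_0(0)-f_n(1)\in B$; 3. $(f_0,\dots,f_n)$ represents $\mathbf f$: an element $f\in M(I)$ satisfies $\pi(f)=\mathbf f$ if and only if, for every $i$, the function $f-f_i$ on $X_i$ is a norm continuous function with values in $B$ that vanishes in norm at any infinite end point of $X_i$. -/

import Mathlib

open Set Filter Topology
open scoped TensorProduct MultiplierAlgebra ZeroAtInfty lp ENNReal

/-! ### Multiplier algebras and coronas -/

namespace DoubleCentralizer

section Ideal

variable {A : Type*} [NonUnitalCStarAlgebra A]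

theorem left_cancel {a b : A} (h : ∀ y : A, y * a = y * b) : a = b := by
  have h1 : star (a - b) * (a - b) = 0 := by rw [mul_sub, h, sub_self]
  exact sub_eq_zero.1 ((CStarRing.star_mul_self_eq_zero_iff _).1 h1)

theorem right_cancel {a b : A} (h : ∀ y : A, a * y = b * y) : a = b := by
  have h1 : (a - b) * star (a - b) = 0 := by rw [sub_mul, h, sub_self]
  exact sub_eq_zero.1 ((CStarRing.mul_star_self_eq_zero_iff _).1 h1)

theorem fst_mul (m : 𝓜(ℂ, A)) (a x : A) : m.fst (a * x) = m.fst a * x :=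
  left_cancel fun y => by
    rw [← m.central, ← mul_assoc, ← mul_assoc, ← m.central]

theorem snd_mul (m : 𝓜(ℂ, A)) (x a : A) : m.snd (x * a) = x * m.snd a :=
  right_cancel fun y => by
    rw [m.central, mul_assoc, mul_assoc, m.central]

theorem mul_coe (m : 𝓜(ℂ, A)) (a : A) : m * (a : 𝓜(ℂ, A)) = ((m.fst a : A) : 𝓜(ℂ, A)) := by
  refine DoubleCentralizer.ext ℂ A _ _ (Prod.ext ?_ ?_)
  · ext x
    simp [fst_mul]
  · ext x
    simp [m.central]

theorem coe_mul (m : 𝓜(ℂ, A)) (a : A) : (a : 𝓜(ℂ, A)) * m = ((m.snd a : A) : 𝓜(ℂ, A)) := by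
  refine DoubleCentralizer.ext ℂ A _ _ (Prod.ext ?_ ?_)
  · ext x
    simp [m.central]
  · ext x
    simp [snd_mul]

end Ideal

end DoubleCentralizer

section Corona

variable (A : Type*) [NonUnitalCStarAlgebra A]

/-- `A`, regarded as a closed two-sided ideal of its multiplier algebra `M(A)`. -/
noncomputable def multiplierIdeal : TwoSidedIdeal 𝓜(ℂ, A) :=
  TwoSidedIdeal.mk' (Set.range fun a : A => (a : 𝓜(ℂ, A)))
    ⟨0, map_zero (DoubleCentralizer.coeHom (𝕜 := ℂ) (A := A))⟩
    (by
      rintro _ _ ⟨a, rfl⟩ ⟨b, rfl⟩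
      exact ⟨a + b, map_add (DoubleCentralizer.coeHom (𝕜 := ℂ) (A := A)) a b⟩)
    (by
      rintro _ ⟨a, rfl⟩
      exact ⟨-a, map_neg (DoubleCentralizer.coeHom (𝕜 := ℂ) (A := A)) a⟩)
    (by
      rintro m _ ⟨a, rfl⟩
      exact ⟨_, (DoubleCentralizer.mul_coe m a).symm⟩)
    (by
      rintro _ m ⟨a, rfl⟩
      exact ⟨_, (DoubleCentralizer.coe_mul m a).symm⟩)

theorem mem_multiplierIdeal {m : 𝓜(ℂ, A)} :
    m ∈ multiplierIdeal A ↔ ∃ a : A, (a : 𝓜(ℂ, A)) = m :=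
  TwoSidedIdeal.mem_mk' _ _ _ _ _ _ m

/-- The corona algebra `M(A)/A`. -/
abbrev Corona : Type _ := (multiplierIdeal A).ringCon.Quotient

variable {A}

/-- The quotient map `π : M(A) → M(A)/A`. -/
noncomputable def toCorona : 𝓜(ℂ, A) →+* Corona A := (multiplierIdeal A).ringCon.mk'

theorem toCorona_surjective : Function.Surjective (toCorona (A := A)) :=
  Quotient.mk''_surjective

theorem star_ringCon {m m' : 𝓜(ℂ, A)} (h : (multiplierIdeal A).ringCon m m') :
    (multiplierIdeal A).ringCon (star m) (star m') := by
  rw [TwoSidedIdeal.rel_iff, mem_multiplierIdeal] at h ⊢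
  obtain ⟨a, ha⟩ := h
  refine ⟨star a, ?_⟩
  rw [← star_sub, ← ha]
  exact map_star (DoubleCentralizer.coeHom (𝕜 := ℂ) (A := A)) a

/-- The involution of the corona algebra, inherited from `M(A)`. -/
noncomputable instance : Star (Corona A) where
  star := Quotient.map' star fun _ _ h => star_ringCon h

theorem toCorona_star (m : 𝓜(ℂ, A)) : toCorona (star m) = star (toCorona m) := rfl

theorem toCorona_eq_iff {m m' : 𝓜(ℂ, A)} :
    toCorona m = toCorona m' ↔ ∃ a : A, (a : 𝓜(ℂ, A)) = m - m' := by
  rw [← mem_multiplierIdeal, ← TwoSidedIdeal.rel_iff]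
  exact RingCon.eq _

noncomputable instance : StarRing (Corona A) where
  star_involutive x := by
    obtain ⟨m, rfl⟩ := toCorona_surjective x
    rw [← toCorona_star, ← toCorona_star, star_star]
  star_mul x y := by
    obtain ⟨m, rfl⟩ := toCorona_surjective x
    obtain ⟨m', rfl⟩ := toCorona_surjective y
    rw [← map_mul, ← toCorona_star, ← toCorona_star, ← toCorona_star, ← map_mul, star_mul]
  star_add x y := by
    obtain ⟨m, rfl⟩ := toCorona_surjective x
    obtain ⟨m', rfl⟩ := toCorona_surjective y
    rw [← map_add, ← toCorona_star, ← toCorona_star, ← toCorona_star, ← map_add, star_add]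

end Corona

/-- The strict topology on `M(B)`: the coarsest topology for which all the maps
`m ↦ m b` and `m ↦ b m` (`b ∈ B`) into the normed space `B` are continuous. -/
@[reducible] noncomputable def strictTopology (B : Type*) [NonUnitalCStarAlgebra B] : TopologicalSpace 𝓜(ℂ, B) :=
  TopologicalSpace.induced
    (fun m => ((fun b => m.fst b, fun b => m.snd b) : (B → B) × (B → B))) inferInstance

theorem continuousOn_strictTopology {B X : Type*} [NonUnitalCStarAlgebra B] [TopologicalSpace X]
    {f : X → 𝓜(ℂ, B)} {S : Set X} :
    @ContinuousOn X 𝓜(ℂ, B) _ (strictTopology B) f S ↔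
      ∀ b : B, ContinuousOn (fun x => (f x).fst b) S ∧ ContinuousOn (fun x => (f x).snd b) S := by
  let := strictTopology B
  have hi : IsInducing
      (fun m : 𝓜(ℂ, B) => ((fun b => m.fst b, fun b => m.snd b) : (B → B) × (B → B))) := ⟨rfl⟩
  rw [hi.continuousOn_iff]
  refine ⟨fun h b => ⟨continuousOn_pi.1 h.fst b, continuousOn_pi.1 h.snd b⟩, fun h => ?_⟩
  exact (continuousOn_pi.2 fun b => (h b).1).prodMk (continuousOn_pi.2 fun b => (h b).2)

/-! ### Real rank zero and stability -/

/-- A unital C*-algebra has real rank zero if the invertible self-adjoint elements are norm dense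
in the self-adjoint elements. -/
def HasRealRankZero (A : Type*) [CStarAlgebra A] : Prop :=
  ∀ a : A, IsSelfAdjoint a → a ∈ closure {b : A | IsSelfAdjoint b ∧ IsUnit b}

section Compact

variable (H : Type*) [NormedAddCommGroup H] [InnerProductSpace ℂ H] [CompleteSpace H]

theorem isCompactOperator_star {T : H →L[ℂ] H} (hT : IsCompactOperator T) :
    IsCompactOperator (star T : H →L[ℂ] H) := by
  have hTT : IsCompactOperator (T * star T : H →L[ℂ] H) :=
    hT.comp_clm (star T : H →L[ℂ] H)
  refine (isCompactOperator_iff_isCompact_closure_image_ball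
    (star T : H →L[ℂ] H).toLinearMap one_pos).2 ?_
  refine TotallyBounded.isCompact_of_isClosed (TotallyBounded.closure ?_) isClosed_closure
  have hc := (hTT.isCompact_closure_image_ball (f := (T * star T : H →L[ℂ] H).toLinearMap) 1)
  have htb := hc.totallyBounded.subset subset_closure
  refine Metric.totallyBounded_iff.2 fun ε hε => ?_
  obtain ⟨t, hts, htf, hcov⟩ := Metric.finite_approx_of_totallyBounded htb (ε ^ 2 / 2) (by positivity)
  have hts' : ∀ y ∈ t, ∃ z, z ∈ Metric.ball (0 : H) 1 ∧
      T ((star T : H →L[ℂ] H) z) = y := fun y hy => hts hy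
  choose! u hu hu' using hts'
  refine ⟨(fun y => (star T : H →L[ℂ] H) (u y)) '' t, htf.image _, ?_⟩
  rintro _ ⟨x, hx, rfl⟩
  have hx' := hcov ⟨x, hx, rfl⟩
  simp only [mem_iUnion, exists_prop] at hx' ⊢
  obtain ⟨y, hy, hxy⟩ := hx'
  refine ⟨_, ⟨y, hy, rfl⟩, ?_⟩
  rw [← hu' y hy] at hxy
  have hn : ‖x - u y‖ < 2 := by
    have h1 : ‖x‖ < 1 := by simpa using hx
    have h2 : ‖u y‖ < 1 := by simpa using hu y hy
    linarith [norm_sub_le x (u y)]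
  have hd : ‖T ((star T : H →L[ℂ] H) (x - u y))‖ < ε ^ 2 / 2 := by
    rw [map_sub, map_sub, ← dist_eq_norm]
    exact hxy
  have hsq : ‖(star T : H →L[ℂ] H) (x - u y)‖ ^ 2 < ε ^ 2 := by
    have h1 : ‖(star T : H →L[ℂ] H) (x - u y)‖ ^ 2 =
        RCLike.re (inner ℂ (x - u y) (T ((star T : H →L[ℂ] H) (x - u y)))) := by
      rw [ContinuousLinearMap.star_eq_adjoint, ← ContinuousLinearMap.adjoint_inner_left,
        inner_self_eq_norm_sq]
    have h2 := re_inner_le_norm (𝕜 := ℂ) (x - u y) (T ((star T : H →L[ℂ] H) (x - u y)))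
    nlinarith [norm_nonneg (x - u y), norm_nonneg (T ((star T : H →L[ℂ] H) (x - u y)))]
  rw [Metric.mem_ball, dist_eq_norm]
  have := lt_of_pow_lt_pow_left₀ 2 hε.le hsq
  rw [map_sub] at this
  exact this

/-- The C*-algebra of compact operators on a Hilbert space `H`. -/
def compactOperators : NonUnitalStarSubalgebra ℂ (H →L[ℂ] H) where
  carrier := {T | IsCompactOperator T}
  add_mem' hS hT := hS.add hT
  zero_mem' := isCompactOperator_zero
  mul_mem' {_ T} hS _ := hS.comp_clm T
  smul_mem' c _ hT := hT.smul c
  star_mem' hT := isCompactOperator_star H hT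

end Compact

/-- `B` is stable, i.e. `B ≅ B ⊗ K` with `K` the compact operators on `ℓ²(ℕ)`: the algebraic tensor
product `B ⊙ K` embeds as a dense *-subalgebra of `B`. (Since `K` is nuclear, `B ⊙ K` carries only
one C*-norm, so such an embedding is the same as an isomorphism of the completion `B ⊗ K`
with `B`.) -/
def IsStableCStarAlgebra (B : Type*) [NonUnitalCStarAlgebra B] : Prop :=
  ∃ φ : (B ⊗[ℂ] compactOperators ℓ²(ℕ, ℂ)) →⋆ₙₐ[ℂ] B, Function.Injective φ ∧ DenseRange φ

/-! ### Representing elements of the corona of `C₀(X, B)` by finitely many functions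

The parameter interval `J ⊆ ℝ` is `[0, 1]`, `[0, ∞)` or `ℝ`, and `q : J → X` is the identity of
`J = X`, or the quotient map `[0, 1] → [0, 1]/{0, 1}` if `X` is the circle. -/

section Representation

variable {B : Type*} [NonUnitalCStarAlgebra B]

/-- The function `F : X → M(B)` corresponding to the multiplier `m` of `C₀(X, B)` under the
identification of `M(C₀(X, B))` with the bounded strictly continuous functions from `X` to `M(B)`:
`m` acts on `C₀(X, B)` by pointwise multiplication by `F`, on both sides. -/
def IsFunctionOf {X : Type*} [TopologicalSpace X] (m : 𝓜(ℂ, C₀(X, B))) (F : X → 𝓜(ℂ, B)) : Prop :=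
  ∀ (g : C₀(X, B)) (x : X), m.fst g x = (F x).fst (g x) ∧ m.snd g x = (F x).snd (g x)

/-- `f` restricts to an element of `C_b(S, M(B)_s)`, i.e. it is bounded and strictly continuous
on `S`. -/
def IsBoundedStrict {X : Type*} [TopologicalSpace X] (f : X → 𝓜(ℂ, B)) (S : Set X) : Prop :=
  @ContinuousOn X 𝓜(ℂ, B) _ (strictTopology B) f S ∧ ∃ C : ℝ, ∀ x ∈ S, ‖f x‖ ≤ C

/-- The partition points `x 0 < ⋯ < x (n - 1)` divide `J` into the `n + 1` closed subintervals
`piece x 0 = {t ≤ x 0}`, `piece x i = [x (i - 1), x i]` for `0 < i < n`, and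
`piece x n = {t ≥ x (n - 1)}`. -/
def piece {J : Set ℝ} {n : ℕ} (x : Fin n → J) (i : Fin (n + 1)) : Set J :=
  {t | ∀ j : Fin n, ((j : ℕ) < i → x j ≤ t) ∧ ((i : ℕ) ≤ j → t ≤ x j)}

variable (B) in
/-- Tuples `(f 0, …, f n)` of functions, `f i` being a bounded strictly continuous function on the
`i`-th closed subinterval of a finite partition of `J`, such that adjacent functions
differ by an element of `B` at the partition points. (The values of `f i` outside the `i`-th
subinterval are irrelevant.) -/
structure PiecewiseFamily (J : Set ℝ) where
  /-- number of partition points -/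
  n : ℕ
  /-- partition points -/
  x : Fin n → J
  strictMono_x : StrictMono x
  x_mem_interior : ∀ j, (x j : ℝ) ∈ interior J
  /-- the functions -/
  f : Fin (n + 1) → J → 𝓜(ℂ, B)
  isBoundedStrict_f : ∀ i, IsBoundedStrict (f i) (piece x i)
  jump : ∀ j : Fin n, ∃ b : B, (b : 𝓜(ℂ, B)) = f j.succ (x j) - f j.castSucc (x j)

namespace PiecewiseFamily

variable {J : Set ℝ}

/-- The family `(f 0, …, f n)` represents the element `z` of the corona of `C₀(X, B)`: the coset
`π⁻¹(z)` consists of exactly those `m` in the multiplier algebra such that `m - f i` is, on each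
subinterval `X_i`, a norm continuous `B`-valued function vanishing at the infinite end
points of `X_i`, i.e. an element of `C₀(X_i, B)`. -/
def Represents (P : PiecewiseFamily B J) {X : Type*} [TopologicalSpace X] (q : J → X)
    (z : Corona C₀(X, B)) : Prop :=
  ∀ m : 𝓜(ℂ, C₀(X, B)), toCorona m = z ↔
    ∃ F : X → 𝓜(ℂ, B), IsFunctionOf m F ∧
      ∀ i, ∃ d : C₀(piece P.x i, B), ∀ t : piece P.x i,
        ((d t : B) : 𝓜(ℂ, B)) = F (q t) - P.f i t

/-- Each `f i` is projection valued on the `i`-th subinterval. -/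
def IsProjectionValued (P : PiecewiseFamily B J) : Prop :=
  ∀ i, ∀ t ∈ piece P.x i, IsStarProjection (P.f i t)

end PiecewiseFamily

end Representation

/-! A projection in the corona lifts to a self-adjoint `m`, which acts as a bounded strictly
continuous function `G` with `G² - G` norm continuous, `B`-valued and vanishing at infinity. It
suffices to perturb `G` on each piece, by a `C₀` function with values in `B`, into a
projection-valued function. Jumps then lie in `B` automatically, since neighbouring functions differ
from the same `G` by elements of `B`.

Two facts give the perturbations. Real rank zero lifts projections from `M(B)/B` to `M(B)`
(`HasRealRankZero.exists_isStarProjection_sub`), so at each `t₀` some `b` in `B` makes `G t₀ - b` a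
projection. Secondly, if `x = 2G - 1` satisfies `x² = 1 + w` with `‖w‖ ≤ 3/4`, then `x (1 +
w)^(-1/2)` is a symmetry differing from `x` by a `B`-valued function as continuous and as small at
infinity as `w` (`HasProjectionPerturbation.of_norm_le`). Applied to `G - b`, this works near `t₀`;
applied to `G` itself, it works near infinity. A Lebesgue number argument leaves finitely many
pieces. -/

/-! ### The isometric embedding of an algebra in its multipliers, and square roots near 1 -/

namespace DoubleCentralizer

variable {A : Type*} [NonUnitalCStarAlgebra A]

theorem coe_zero : ((0 : A) : 𝓜(ℂ, A)) = 0 := map_zero (coeHom (𝕜 := ℂ) (A := A))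

theorem coe_add (a b : A) : ((a + b : A) : 𝓜(ℂ, A)) = a + b :=
  map_add (coeHom (𝕜 := ℂ) (A := A)) a b

theorem coe_sub (a b : A) : ((a - b : A) : 𝓜(ℂ, A)) = a - b :=
  map_sub (coeHom (𝕜 := ℂ) (A := A)) a b

theorem coe_neg (a : A) : ((-a : A) : 𝓜(ℂ, A)) = -a := map_neg (coeHom (𝕜 := ℂ) (A := A)) a

theorem coe_smul (c : ℂ) (a : A) : ((c • a : A) : 𝓜(ℂ, A)) = c • (a : 𝓜(ℂ, A)) :=
  map_smul (coeHom (𝕜 := ℂ) (A := A)) c a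

theorem coe_mul_coe (a b : A) : ((a * b : A) : 𝓜(ℂ, A)) = a * b :=
  map_mul (coeHom (𝕜 := ℂ) (A := A)) a b

theorem coe_star (a : A) : ((star a : A) : 𝓜(ℂ, A)) = star (a : 𝓜(ℂ, A)) :=
  map_star (coeHom (𝕜 := ℂ) (A := A)) a

theorem coe_injective : Function.Injective fun a : A => (a : 𝓜(ℂ, A)) := fun a b h =>
  left_cancel fun y => by
    have h1 : (a : 𝓜(ℂ, A)).snd y = (b : 𝓜(ℂ, A)).snd y := congrArg (fun m => m.snd y) h
    simpa using h1

theorem norm_coe (a : A) : ‖(a : 𝓜(ℂ, A))‖ = ‖a‖ :=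
  NonUnitalStarAlgHom.norm_map (coeHom (𝕜 := ℂ) (A := A)) coe_injective a

theorem isometry_coe : Isometry fun a : A => (a : 𝓜(ℂ, A)) :=
  AddMonoidHomClass.isometry_of_norm (coeHom (𝕜 := ℂ) (A := A)) norm_coe

theorem isSelfAdjoint_coe {a : A} : IsSelfAdjoint (a : 𝓜(ℂ, A)) ↔ IsSelfAdjoint a := by
  rw [IsSelfAdjoint, IsSelfAdjoint, ← coe_star]
  exact coe_injective.eq_iff

end DoubleCentralizer

open DoubleCentralizer

theorem isClosed_multiplierIdeal (A : Type*) [NonUnitalCStarAlgebra A] :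
    IsClosed {m : 𝓜(ℂ, A) | m ∈ multiplierIdeal A} := by
  have h : {m : 𝓜(ℂ, A) | m ∈ multiplierIdeal A} = range fun a : A => (a : 𝓜(ℂ, A)) := by
    ext m
    exact mem_multiplierIdeal A
  rw [h]
  exact isometry_coe.isClosedEmbedding.isClosed_range

/-- Square roots of elements close to `1`, inside a closed subspace stable under squaring. -/
theorem exists_one_add_mul_self_eq {A : Type*} [NormedRing A] [NormedAlgebra ℝ A] [CompleteSpace A]
    (S : Submodule ℝ A) (hS : IsClosed (S : Set A)) (hmul : ∀ h ∈ S, h * h ∈ S) {t : A}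
    (ht : t ∈ S) (htn : ‖t‖ ≤ 1 / 4) :
    ∃ h ∈ S, ‖h‖ ≤ 1 / 2 ∧ (1 + h) * (1 + h) = 1 + t := by
  let s : Set A := (S : Set A) ∩ Metric.closedBall 0 (1 / 2)
  -- A fixed point satisfies `2h + h² = t`. On the ball of radius `1/2` the Lipschitz constant is at
  -- most `(‖h‖ + ‖k‖)/2 ≤ 1/2`. Iterating from 0 stays in `S` and needs no normality of `t`.
  let φ : A → A := fun h => (1 / 2 : ℝ) • (t - h * h)
  have hs : IsComplete s := (hS.inter Metric.isClosed_closedBall).isComplete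
  have hmaps : MapsTo φ s s := by
    rintro h ⟨h1, h2⟩
    refine ⟨S.smul_mem _ (S.sub_mem ht (hmul h h1)), ?_⟩
    rw [mem_closedBall_zero_iff] at h2 ⊢
    have h3 := norm_mul_le h h
    have h4 := norm_sub_le t (h * h)
    rw [norm_smul, Real.norm_of_nonneg (by norm_num)]
    nlinarith [norm_nonneg h]
  have hcontr : ContractingWith (1 / 2) (hmaps.restrict φ s s) := by
    refine ⟨by norm_num, LipschitzWith.of_dist_le_mul fun ⟨h, h1, h2⟩ ⟨k, k1, k2⟩ => ?_⟩
    rw [mem_closedBall_zero_iff] at h2 k2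
    change dist (φ h) (φ k) ≤ _ * dist h k
    have e : φ h - φ k = (1 / 2 : ℝ) • ((k - h) * k + h * (k - h)) := by
      simp only [φ, ← smul_sub]
      congr 1
      noncomm_ring
    have h3 := norm_add_le ((k - h) * k) (h * (k - h))
    have h4 := norm_mul_le (k - h) k
    have h5 := norm_mul_le h (k - h)
    rw [dist_eq_norm, e, norm_smul, Real.norm_of_nonneg (by norm_num), dist_comm, dist_eq_norm]
    simp only [NNReal.coe_div, NNReal.coe_one, NNReal.coe_ofNat]
    nlinarith [norm_nonneg (k - h)]
  obtain ⟨h, ⟨h1, h2⟩, h3, -⟩ := hcontr.exists_fixedPoint' hs hmaps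
    (x := 0) ⟨S.zero_mem, by simp⟩ (edist_ne_top _ _)
  refine ⟨h, h1, by simpa using h2, ?_⟩
  have h4 : h + h = t - h * h := by
    nth_rw 1 2 [← h3.eq]
    simp only [φ]
    rw [← add_smul]
    norm_num
  have : (1 + h) * (1 + h) = 1 + (h + h) + h * h := by noncomm_ring
  rw [this, h4]
  abel

/-! ### Lifting projections from `M(B)/B` to `M(B)` -/

section RealRankZero

variable {B : Type*} [NonUnitalCStarAlgebra B]

/-- If `M(B)` has real rank zero, self-adjoint multipliers that are symmetries modulo `B` have
invertible self-adjoint perturbations by elements of `B`. -/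
theorem HasRealRankZero.exists_isUnit_sub_mem (hM : HasRealRankZero 𝓜(ℂ, B)) {x : 𝓜(ℂ, B)}
    (hx : IsSelfAdjoint x) (hx2 : x * x - 1 ∈ multiplierIdeal B) :
    ∃ y : 𝓜(ℂ, B), IsSelfAdjoint y ∧ IsUnit y ∧ y - x ∈ multiplierIdeal B := by
  set I := multiplierIdeal B
  -- The tolerance makes `‖x (z - x)‖ ≤ 1/4`, as the square root of `1 + x (z - x)` requires.
  obtain ⟨z, ⟨hz, hzu⟩, hzx⟩ := Metric.mem_closure_iff.1 (hM x hx) (1 / (4 * (‖x‖ + 1)))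
    (by positivity)
  set r := z - x with hr
  have hrs : IsSelfAdjoint r := hz.sub hx
  have hrn : ‖x * r‖ ≤ 1 / 4 := by
    rw [dist_comm, dist_eq_norm, ← hr, lt_div_iff₀ (by positivity)] at hzx
    have := norm_mul_le x r
    nlinarith [norm_nonneg r]
  -- The `h` with `x h ≡ h* x` modulo `B`: only a real subspace, because of the star, but stable
  -- under squaring. It contains `x r` since `x² ≡ 1`, so the square root of `1 + x r` can be taken
  -- in `1 + S`.
  let S : Submodule ℝ 𝓜(ℂ, B) :=
    { carrier := {h | x * h - star h * x ∈ I}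
      add_mem' := by
        intro a b ha hb
        have := I.add_mem ha hb
        have e : x * (a + b) - star (a + b) * x
            = (x * a - star a * x) + (x * b - star b * x) := by rw [star_add]; noncomm_ring
        rw [mem_ofPred_eq, e]
        exact this
      zero_mem' := by simp [I.zero_mem]
      smul_mem' := by
        intro c a ha
        have e : x * (c • a) - star (c • a) * x
            = (algebraMap ℝ 𝓜(ℂ, B) c) * (x * a - star a * x) := by
          rw [star_smul, ← Algebra.smul_def, smul_sub, mul_smul_comm, smul_mul_assoc, star_trivial]
        rw [mem_ofPred_eq, e]
        exact I.mul_mem_left _ _ ha }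
  have hScl : IsClosed (S : Set 𝓜(ℂ, B)) :=
    (isClosed_multiplierIdeal B).preimage (f := fun h => x * h - star h * x) (by fun_prop)
  have hSmul : ∀ h ∈ S, h * h ∈ S := by
    intro h (hh : x * h - star h * x ∈ I)
    have e : x * (h * h) - star (h * h) * x
        = (x * h - star h * x) * h + star h * (x * h - star h * x) := by
      rw [star_mul]; noncomm_ring
    change x * (h * h) - star (h * h) * x ∈ I
    rw [e]
    exact I.add_mem (I.mul_mem_right _ _ hh) (I.mul_mem_left _ _ hh)
  have ht : x * r ∈ S := by
    have e : x * (x * r) - star (x * r) * x = (x * x - 1) * r - r * (x * x - 1) := by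
      rw [star_mul, hx.star_eq, hrs.star_eq]; noncomm_ring
    change x * (x * r) - star (x * r) * x ∈ I
    rw [e]
    exact I.sub_mem (I.mul_mem_right _ _ hx2) (I.mul_mem_left _ _ hx2)
  obtain ⟨h, hhS, hhn, hh⟩ := exists_one_add_mul_self_eq S hScl hSmul ht hrn
  have hhI : x * h - star h * x ∈ I := hhS
  have hwu : IsUnit (1 + h) := by
    have := (Units.oneSub (-h) (by rw [norm_neg]; linarith)).isUnit
    simpa using this
  obtain ⟨w, hw⟩ := hwu
  have hwI : x * (w : 𝓜(ℂ, B)) - star (w : 𝓜(ℂ, B)) * x ∈ I := by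
    have e : x * (w : 𝓜(ℂ, B)) - star (w : 𝓜(ℂ, B)) * x = x * h - star h * x := by
      rw [hw, star_add, star_one]; noncomm_ring
    rwa [e]
  -- Modulo `B`: `w* x w ≡ x w² = x (1 + x r) ≡ x + r = z`. Undoing this congruence by `w⁻¹` turns
  -- the invertible `z` into an invertible element congruent to `x`.
  have key : z - star (w : 𝓜(ℂ, B)) * x * w ∈ I := by
    have e1 : x * ((w : 𝓜(ℂ, B)) * w) = x * (1 + x * r) := by rw [hw, hh]
    have e : z - star (w : 𝓜(ℂ, B)) * x * w
        = (x * (w : 𝓜(ℂ, B)) - star (w : 𝓜(ℂ, B)) * x) * w - (x * x - 1) * r := by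
      have : z = x + r := by rw [hr]; abel
      rw [sub_mul (x * (w : 𝓜(ℂ, B))), mul_assoc x, e1, this]
      noncomm_ring
    rw [e]
    exact I.sub_mem (I.mul_mem_right _ _ hwI) (I.mul_mem_right _ _ hx2)
  refine ⟨star (↑w⁻¹ : 𝓜(ℂ, B)) * z * (↑w⁻¹ : 𝓜(ℂ, B)), hz.conjugate' _, ?_, ?_⟩
  · exact (((w⁻¹).isUnit.star).mul hzu).mul (w⁻¹).isUnit
  · have hw1 : star (↑w⁻¹ : 𝓜(ℂ, B)) * star (w : 𝓜(ℂ, B)) = 1 := by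
      rw [← star_mul, Units.mul_inv, star_one]
    have e : star (↑w⁻¹ : 𝓜(ℂ, B)) * z * (↑w⁻¹ : 𝓜(ℂ, B)) - x
        = star (↑w⁻¹ : 𝓜(ℂ, B)) * (z - star (w : 𝓜(ℂ, B)) * x * w) * (↑w⁻¹ : 𝓜(ℂ, B)) := by
      have e2 : star (↑w⁻¹ : 𝓜(ℂ, B)) * (star (w : 𝓜(ℂ, B)) * x * w) * (↑w⁻¹ : 𝓜(ℂ, B)) = x := by
        rw [mul_assoc, mul_assoc _ _ (↑w⁻¹ : 𝓜(ℂ, B)), Units.mul_inv, mul_one, ← mul_assoc, hw1,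
          one_mul]
      rw [mul_sub, sub_mul, e2]
    rw [e]
    exact I.mul_mem_right _ _ (I.mul_mem_left _ _ key)

/-- The function `s ↦ (1 + s)^(-1/2) - 1`, cut off at `s = δ - 1`. -/
noncomputable def invSqrtSubOne (δ s : ℝ) : ℝ := (√(max (1 + s) δ))⁻¹ - 1

theorem continuous_invSqrtSubOne {δ : ℝ} (hδ : 0 < δ) : Continuous (invSqrtSubOne δ) := by
  unfold invSqrtSubOne
  refine Continuous.sub (Continuous.inv₀ (by fun_prop) fun s => ?_) continuous_const
  exact (Real.sqrt_pos.2 (hδ.trans_le (le_max_right _ _))).ne'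

theorem invSqrtSubOne_zero {δ : ℝ} (hδ : δ ≤ 1) : invSqrtSubOne δ 0 = 0 := by
  simp [invSqrtSubOne, hδ]

/-- The non-unital calculus keeps the correction inside `B`; the unital one in `M(B)` is where its
algebra is checked. -/
theorem coe_cfcₙ {δ : ℝ} (hδ : 0 < δ) (hδ1 : δ ≤ 1) {w : B} (hw : IsSelfAdjoint w) :
    ((cfcₙ (invSqrtSubOne δ) w : B) : 𝓜(ℂ, B)) = cfc (invSqrtSubOne δ) (w : 𝓜(ℂ, B)) := by
  have h := NonUnitalStarAlgHomClass.map_cfcₙ (S := ℂ) (coeHom (𝕜 := ℂ) (A := B)) (invSqrtSubOne δ) w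
    (continuous_invSqrtSubOne hδ).continuousOn (invSqrtSubOne_zero hδ1) isometry_coe.continuous hw
    (isSelfAdjoint_coe.2 hw)
  rw [← cfcₙ_eq_cfc (continuous_invSqrtSubOne hδ).continuousOn (invSqrtSubOne_zero hδ1)]
  exact h

/-- If `x` is self-adjoint and `x² - 1 = w` with `1 + w ≥ δ`, then `(1 + x (1 + w)^(-1/2)) / 2` is a
projection. -/
theorem isStarProjection_symmetry {δ : ℝ} (hδ : 0 < δ) (hδ1 : δ ≤ 1) {x : 𝓜(ℂ, B)}
    (hx : IsSelfAdjoint x) {w : B} (hw : (w : 𝓜(ℂ, B)) = x * x - 1)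
    (hspec : spectrum ℝ (w : 𝓜(ℂ, B)) ⊆ Ici (δ - 1)) :
    IsStarProjection ((1 / 2 : ℂ) • (1 + x * (1 + ((cfcₙ (invSqrtSubOne δ) w : B) : 𝓜(ℂ, B))))) := by
  have hws' : IsSelfAdjoint (w : 𝓜(ℂ, B)) := by
    rw [hw]
    exact (by simpa [hx.star_eq] using IsSelfAdjoint.star_mul_self x : IsSelfAdjoint (x * x)).sub
      (IsSelfAdjoint.one _)
  have hws : IsSelfAdjoint w := isSelfAdjoint_coe.1 hws'
  rw [coe_cfcₙ hδ hδ1 hws]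
  set r := cfc (invSqrtSubOne δ) (w : 𝓜(ℂ, B)) with hr
  have hrs : IsSelfAdjoint r := cfc_predicate _ _
  have hcom : Commute (w : 𝓜(ℂ, B)) x := by
    rw [hw, commute_iff_eq]
    noncomm_ring
  have hrx : Commute r x := IsSelfAdjoint.commute_cfc hws' hcom _
  have hcont := (continuous_invSqrtSubOne hδ).continuousOn (s := spectrum ℝ (w : 𝓜(ℂ, B)))
  have h1 : (1 + (w : 𝓜(ℂ, B))) * ((1 + r) * (1 + r)) = 1 := by
    have e1 : 1 + r = cfc (fun s => 1 + invSqrtSubOne δ s) (w : 𝓜(ℂ, B)) := by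
      rw [cfc_const_add (1 : ℝ) (invSqrtSubOne δ) _ hcont hws', map_one]
    have e2 : 1 + (w : 𝓜(ℂ, B)) = cfc (fun s : ℝ => 1 + s) (w : 𝓜(ℂ, B)) := by
      rw [cfc_const_add (1 : ℝ) (fun s => s) _ (by fun_prop) hws', map_one, cfc_id' ℝ _ hws']
    have hc1 := hcont.const_add (1 : ℝ)
    rw [e1, e2, ← cfc_mul _ _ _ hc1 hc1,
      ← cfc_mul (fun s : ℝ => 1 + s) _ _ (by fun_prop) (hc1.fun_mul hc1),
      ← cfc_const_one ℝ (w : 𝓜(ℂ, B)) hws']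
    -- On the spectrum `1 + s ≥ δ`, so the cut-off is inactive.
    refine cfc_congr fun s hs => ?_
    have hs1 : δ ≤ 1 + s := by have := hspec hs; rw [mem_Ici] at this; linarith
    have hs0 : 0 < 1 + s := hδ.trans_le hs1
    simp only [invSqrtSubOne, max_eq_left hs1]
    have h2 : √(1 + s) * √(1 + s) = 1 + s := Real.mul_self_sqrt hs0.le
    have h3 : √(1 + s) ≠ 0 := (Real.sqrt_pos.2 hs0).ne'
    field_simp
    nlinarith
  have h2 : (x * (1 + r)) * (x * (1 + r)) = 1 := by
    have e : (1 + r) * x = x * (1 + r) := by rw [add_mul, mul_add, hrx.eq, one_mul, mul_one]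
    have e' : 1 + (w : 𝓜(ℂ, B)) = x * x := by rw [hw]; abel
    rw [mul_assoc, ← mul_assoc (1 + r), e, mul_assoc x, ← mul_assoc, ← e', h1]
  have h3 : IsSelfAdjoint (x * (1 + r)) := by
    rw [IsSelfAdjoint, star_mul, hx.star_eq, star_add, star_one, hrs.star_eq, add_mul, mul_add,
      hrx.eq, one_mul, mul_one]
  refine ⟨?_, ?_⟩
  · rw [IsIdempotentElem, smul_mul_smul_comm]
    have : (1 + x * (1 + r)) * (1 + x * (1 + r)) = (2 : ℂ) • (1 + x * (1 + r)) := by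
      rw [mul_add, add_mul, add_mul, h2, two_smul]
      noncomm_ring
    rw [this, smul_smul]
    norm_num
  · rw [IsSelfAdjoint, star_smul, star_add, star_one, h3.star_eq]
    norm_num

theorem mem_multiplierIdeal_mul_self_sub {x y : 𝓜(ℂ, B)} (h : y - x ∈ multiplierIdeal B) :
    y * y - x * x ∈ multiplierIdeal B := by
  have e : y * y - x * x = y * (y - x) + (y - x) * x := by noncomm_ring
  rw [e]
  exact (multiplierIdeal B).add_mem ((multiplierIdeal B).mul_mem_left _ _ h)
    ((multiplierIdeal B).mul_mem_right _ _ h)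

/-- If `M(B)` has real rank zero, projections of `M(B)/B` lift to projections of `M(B)`. -/
theorem HasRealRankZero.exists_isStarProjection_sub (hM : HasRealRankZero 𝓜(ℂ, B)) {a : 𝓜(ℂ, B)}
    (ha : IsSelfAdjoint a) (ha2 : a * a - a ∈ multiplierIdeal B) :
    ∃ b : B, IsStarProjection (a - (b : 𝓜(ℂ, B))) := by
  set I := multiplierIdeal B
  set x := a + a - 1 with hx
  have hxs : IsSelfAdjoint x := (ha.add ha).sub (IsSelfAdjoint.one _)
  have hx2 : x * x - 1 ∈ I := by
    have e : x * x - 1 = (a * a - a) + (a * a - a) + ((a * a - a) + (a * a - a)) := by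
      rw [hx]; noncomm_ring
    rw [e]
    exact I.add_mem (I.add_mem ha2 ha2) (I.add_mem ha2 ha2)
  obtain ⟨y, hys, hyu, hyx⟩ := hM.exists_isUnit_sub_mem hxs hx2
  have hy2 : y * y - 1 ∈ I := by
    have := I.add_mem (mem_multiplierIdeal_mul_self_sub hyx) hx2
    rwa [sub_add_sub_cancel] at this
  obtain ⟨w, hw⟩ := (mem_multiplierIdeal B).1 hy2
  obtain ⟨c, hc⟩ := (mem_multiplierIdeal B).1 hyx
  -- The spectrum of `y²` is nonnegative and misses a ball around 0, whose radius provides the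
  -- cut-off; the minimum with 1 keeps `invSqrtSubOne` zero at 0.
  have hy0 : (0 : ℝ) ∉ spectrum ℝ (y * y) := spectrum.zero_notMem ℝ (hyu.mul hyu)
  obtain ⟨δ, hδ, hball⟩ := Metric.isOpen_iff.1 (spectrum.isClosed (𝕜 := ℝ) (y * y)).isOpen_compl 0 hy0
  have hspec : spectrum ℝ (w : 𝓜(ℂ, B)) ⊆ Ici (min δ 1 - 1) := by
    intro s hs
    have hs' : 1 + s ∈ spectrum ℝ (y * y) := by
      have := spectrum.add_mem_add_iff (R := ℝ) (a := (w : 𝓜(ℂ, B))) (r := s) (s := 1)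
      rw [map_one, hw] at this
      rw [hw] at hs
      have h2 := this.2 hs
      rwa [add_sub_cancel, add_comm] at h2
    have hpos : 0 ≤ 1 + s := by
      nth_rw 1 [← hys.star_eq] at hs'
      exact spectrum_star_mul_self_nonneg _ hs'
    by_contra hlt
    rw [mem_Ici, not_le] at hlt
    refine hball ?_ hs'
    rw [Metric.mem_ball, dist_zero_right, Real.norm_of_nonneg hpos]
    linarith [min_le_left δ 1]
  have hp := isStarProjection_symmetry (lt_min hδ one_pos) (min_le_right _ _) hys hw hspec
  set r := cfcₙ (invSqrtSubOne (min δ 1)) w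
  -- With `y = 2a - 1 + c`, the projection `(1 + y (1 + r))/2` equals `a + (c + y r)/2`.
  refine ⟨-((1 / 2 : ℂ) • (c + y.fst r)), ?_⟩
  convert hp using 1
  have hy : y = (2 : ℂ) • a - 1 + (c : 𝓜(ℂ, B)) := by rw [hc, hx, two_smul]; abel
  rw [coe_neg, coe_smul, coe_add, ← mul_coe, mul_add, mul_one, sub_neg_eq_add, smul_add, smul_add,
    smul_add]
  nth_rw 2 [hy]
  rw [smul_add, smul_sub, smul_smul]
  norm_num
  abel

end RealRankZero

/-! ### Multipliers of `C₀(X, B)` as functions into `M(B)` -/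

section Functions

variable {B : Type*} [NonUnitalCStarAlgebra B] {X : Type*} [TopologicalSpace X]

theorem ZeroAtInftyContinuousMap.norm_apply_le (g : C₀(X, B)) (x : X) : ‖g x‖ ≤ ‖g‖ :=
  g.toBCF.norm_coe_le_norm x

/-- Multiply `b` by a compactly supported bump. Linearity in `b` makes `b ↦ m.fst (T b) x` an
operator; equality on a whole neighbourhood yields strict continuity. -/
theorem ZeroAtInftyContinuousMap.exists_linear_section [T2Space X] [LocallyCompactSpace X] (x₀ : X) :
    ∃ T : B →ₗ[ℂ] C₀(X, B), (∀ᶠ x in 𝓝 x₀, ∀ b, T b x = b) ∧ ∀ b, ‖T b‖ ≤ ‖b‖ := by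
  obtain ⟨K, hK, hxK⟩ := exists_compact_mem_nhds x₀
  obtain ⟨χ, h1, -, hcs, h01⟩ := exists_continuous_one_zero_of_isCompact hK isClosed_empty
    (disjoint_empty K)
  let T : B →ₗ[ℂ] C₀(X, B) :=
    { toFun := fun b => ⟨⟨fun x => (χ x : ℂ) • b, by fun_prop⟩, by
        have hc : HasCompactSupport fun x => (χ x : ℂ) • b :=
          hcs.mono fun x hx h0 => hx (by simp [h0])
        exact hc.is_zero_at_infty⟩
      map_add' := fun a b => by ext x; exact smul_add _ _ _
      map_smul' := fun c b => by ext x; exact smul_comm _ _ _ }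
  have hT : ∀ b x, T b x = (χ x : ℂ) • b := fun _ _ => rfl
  refine ⟨T, ?_, fun b => ?_⟩
  · filter_upwards [hxK] with x hx b
    rw [hT, h1 hx]
    simp
  · rw [← ZeroAtInftyContinuousMap.norm_toBCF_eq_norm,
      BoundedContinuousFunction.norm_le (norm_nonneg b)]
    intro x
    change ‖T b x‖ ≤ _
    rw [hT, norm_smul, Complex.norm_real, Real.norm_of_nonneg (h01 x).1]
    exact mul_le_of_le_one_left (norm_nonneg b) (h01 x).2

namespace IsFunctionOf

variable {m m' : 𝓜(ℂ, C₀(X, B))} {F F' : X → 𝓜(ℂ, B)}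

theorem mul (h : IsFunctionOf m F) (h' : IsFunctionOf m' F') :
    IsFunctionOf (m * m') fun x => F x * F' x := fun g x => by
  constructor
  · rw [mul_fst, mul_fst, mul_apply_eq_comp, mul_apply_eq_comp, (h _ x).1,
      (h' _ x).1]
  · rw [mul_snd, mul_snd, mul_apply_eq_comp, mul_apply_eq_comp, (h' _ x).2,
      (h _ x).2]

theorem sub (h : IsFunctionOf m F) (h' : IsFunctionOf m' F') :
    IsFunctionOf (m - m') fun x => F x - F' x := fun g x => by
  constructor
  · rw [sub_fst, sub_fst, sub_apply, ZeroAtInftyContinuousMap.sub_apply, (h _ x).1, (h' _ x).1,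
      sub_apply]
  · rw [sub_snd, sub_snd, sub_apply, ZeroAtInftyContinuousMap.sub_apply, (h _ x).2, (h' _ x).2,
      sub_apply]

theorem coe (a : C₀(X, B)) :
    IsFunctionOf (a : 𝓜(ℂ, C₀(X, B))) fun x => ((a x : B) : 𝓜(ℂ, B)) := fun g x => by
  constructor <;> simp

theorem eq_of_forall (h : IsFunctionOf m F) (h' : IsFunctionOf m' F') (hF : ∀ x, F x = F' x) :
    m = m' := by
  refine DoubleCentralizer.ext ℂ _ _ _ (Prod.ext ?_ ?_)
  · ext g x
    change m.fst g x = m'.fst g x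
    rw [(h g x).1, (h' g x).1, hF]
  · ext g x
    change m.snd g x = m'.snd g x
    rw [(h g x).2, (h' g x).2, hF]

end IsFunctionOf

variable [T2Space X] [LocallyCompactSpace X]

theorem ZeroAtInftyContinuousMap.exists_apply_eq (x : X) (b : B) : ∃ g : C₀(X, B), g x = b := by
  obtain ⟨T, hT, -⟩ := ZeroAtInftyContinuousMap.exists_linear_section (B := B) x
  exact ⟨T b, hT.self_of_nhds b⟩

/-- By centrality, `k x * m.fst g x = m.snd k x * g x` sees `g` only through `g x`, and `k x` is
arbitrary. -/
theorem fst_apply_congr (m : 𝓜(ℂ, C₀(X, B))) {g h : C₀(X, B)} {x : X} (hgh : g x = h x) :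
    m.fst g x = m.fst h x := by
  refine left_cancel fun y => ?_
  obtain ⟨k, rfl⟩ := ZeroAtInftyContinuousMap.exists_apply_eq x y
  have h1 := DFunLike.congr_fun (m.central k g) x
  have h2 := DFunLike.congr_fun (m.central k h) x
  simp only [ZeroAtInftyContinuousMap.mul_apply] at h1 h2
  rw [← h1, ← h2, hgh]

theorem snd_apply_congr (m : 𝓜(ℂ, C₀(X, B))) {g h : C₀(X, B)} {x : X} (hgh : g x = h x) :
    m.snd g x = m.snd h x := by
  refine right_cancel fun y => ?_
  obtain ⟨k, rfl⟩ := ZeroAtInftyContinuousMap.exists_apply_eq x y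
  have h1 := DFunLike.congr_fun (m.central g k) x
  have h2 := DFunLike.congr_fun (m.central h k) x
  simp only [ZeroAtInftyContinuousMap.mul_apply] at h1 h2
  rw [h1, h2, hgh]

/-- Multipliers of `C₀(X, B)` act by pointwise multiplication by a bounded function. -/
theorem exists_isFunctionOf (m : 𝓜(ℂ, C₀(X, B))) :
    ∃ F : X → 𝓜(ℂ, B), IsFunctionOf m F ∧ ∀ x, ‖F x‖ ≤ ‖m‖ := by
  choose T hT hTn using fun x : X => ZeroAtInftyContinuousMap.exists_linear_section (B := B) x
  have hTx : ∀ x b, T x b x = b := fun x b => (hT x).self_of_nhds b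
  have hb1 : ∀ x b, ‖m.fst (T x b) x‖ ≤ ‖m‖ * ‖b‖ := fun x b => by
    refine (ZeroAtInftyContinuousMap.norm_apply_le _ _).trans ((m.fst.le_opNorm _).trans ?_)
    rw [norm_fst]
    exact mul_le_mul_of_nonneg_left (hTn x b) (norm_nonneg m)
  have hb2 : ∀ x b, ‖m.snd (T x b) x‖ ≤ ‖m‖ * ‖b‖ := fun x b => by
    refine (ZeroAtInftyContinuousMap.norm_apply_le _ _).trans ((m.snd.le_opNorm _).trans ?_)
    rw [norm_snd]
    exact mul_le_mul_of_nonneg_left (hTn x b) (norm_nonneg m)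
  let L : X → B →L[ℂ] B := fun x => LinearMap.mkContinuous
    { toFun := fun b => m.fst (T x b) x
      map_add' := fun a b => by rw [map_add, map_add, ZeroAtInftyContinuousMap.add_apply]
      map_smul' := fun c b => by
        rw [map_smul, map_smul, ZeroAtInftyContinuousMap.smul_apply, RingHom.id_apply] }
    ‖m‖ (hb1 x)
  let R : X → B →L[ℂ] B := fun x => LinearMap.mkContinuous
    { toFun := fun b => m.snd (T x b) x
      map_add' := fun a b => by rw [map_add, map_add, ZeroAtInftyContinuousMap.add_apply]
      map_smul' := fun c b => by
        rw [map_smul, map_smul, ZeroAtInftyContinuousMap.smul_apply, RingHom.id_apply] }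
    ‖m‖ (hb2 x)
  have hL : ∀ x b, L x b = m.fst (T x b) x := fun _ _ => rfl
  have hR : ∀ x b, R x b = m.snd (T x b) x := fun _ _ => rfl
  refine ⟨fun x => ⟨(L x, R x), fun a b => ?_⟩, fun g x => ⟨?_, ?_⟩, fun x => ?_⟩
  · have h := DFunLike.congr_fun (m.central (T x a) (T x b)) x
    simp only [ZeroAtInftyContinuousMap.mul_apply, hTx] at h
    exact h
  · exact fst_apply_congr m (hTx x (g x)).symm
  · exact snd_apply_congr m (hTx x (g x)).symm
  · rw [← norm_fst]
    exact (L x).opNorm_le_bound (norm_nonneg m) (hb1 x)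

namespace IsFunctionOf

variable {m m' : 𝓜(ℂ, C₀(X, B))} {F F' : X → 𝓜(ℂ, B)}

theorem ext_apply {M N : 𝓜(ℂ, B)} (x : X) (h1 : ∀ g : C₀(X, B), M.fst (g x) = N.fst (g x))
    (h2 : ∀ g : C₀(X, B), M.snd (g x) = N.snd (g x)) : M = N := by
  refine DoubleCentralizer.ext ℂ B _ _ (Prod.ext ?_ ?_)
  · ext b
    obtain ⟨g, rfl⟩ := ZeroAtInftyContinuousMap.exists_apply_eq x b
    exact h1 g
  · ext b
    obtain ⟨g, rfl⟩ := ZeroAtInftyContinuousMap.exists_apply_eq x b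
    exact h2 g

/-- Near `x₀`, `F x` applied to `b` is the value at `x` of `m` applied to one fixed section of `b`,
an element of `C₀(X, B)`. -/
theorem continuous (h : IsFunctionOf m F) (b : B) :
    Continuous (fun x => (F x).fst b) ∧ Continuous fun x => (F x).snd b := by
  refine ⟨continuous_iff_continuousAt.2 fun x₀ => ?_, continuous_iff_continuousAt.2 fun x₀ => ?_⟩
  · obtain ⟨T, hT, -⟩ := ZeroAtInftyContinuousMap.exists_linear_section (B := B) x₀
    refine ((map_continuous (m.fst (T b))).continuousAt (x := x₀)).congr ?_
    filter_upwards [hT] with x hx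
    rw [(h (T b) x).1, hx]
  · obtain ⟨T, hT, -⟩ := ZeroAtInftyContinuousMap.exists_linear_section (B := B) x₀
    refine ((map_continuous (m.snd (T b))).continuousAt (x := x₀)).congr ?_
    filter_upwards [hT] with x hx
    rw [(h (T b) x).2, hx]

theorem isSelfAdjoint (h : IsFunctionOf m F) (hm : IsSelfAdjoint m) (x : X) :
    IsSelfAdjoint (F x) := by
  refine ext_apply x (fun g => ?_) (fun g => ?_)
  · rw [star_fst, ← (h g x).1]
    conv_rhs => rw [← hm.star_eq]
    rw [star_fst, ZeroAtInftyContinuousMap.star_apply, (h _ x).2,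
      ZeroAtInftyContinuousMap.star_apply]
  · rw [star_snd, ← (h g x).2]
    conv_rhs => rw [← hm.star_eq]
    rw [star_snd, ZeroAtInftyContinuousMap.star_apply, (h _ x).1,
      ZeroAtInftyContinuousMap.star_apply]

theorem unique (h : IsFunctionOf m F) (h' : IsFunctionOf m F') (x : X) : F x = F' x :=
  ext_apply x (fun g => by rw [← (h g x).1, (h' g x).1]) fun g => by rw [← (h g x).2, (h' g x).2]

end IsFunctionOf

end Functions

/-! ### Perturbing almost projections to projections -/

section Perturbation

variable {B : Type*} [NonUnitalCStarAlgebra B] {Y : Type*} [TopologicalSpace Y]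

/-- On `S`, some perturbation of `G` by an element of `C₀(S, B)` is projection valued. -/
def HasProjectionPerturbation (G : Y → 𝓜(ℂ, B)) (S : Set Y) : Prop :=
  ∃ d : C₀(S, B), ∀ t : S, IsStarProjection (G t - ((d t : B) : 𝓜(ℂ, B)))

theorem HasProjectionPerturbation.mono {G : Y → 𝓜(ℂ, B)} {S S' : Set Y}
    (h : HasProjectionPerturbation G S) (hS' : IsClosed S') (hsub : S' ⊆ S) :
    HasProjectionPerturbation G S' := by
  obtain ⟨d, hd⟩ := h
  have hcl : IsClosedEmbedding (inclusion hsub) :=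
    .inclusion hsub (hS'.preimage continuous_subtype_val)
  refine ⟨d.comp ⟨⟨inclusion hsub, continuous_inclusion hsub⟩, hcl.tendsto_cocompact⟩, fun t => ?_⟩
  exact hd (inclusion hsub t)

/-- Strict continuity alone handles a fixed vector; the uniform bound on `F` absorbs the variation
`r z - r z₀`. -/
theorem continuous_fst_apply {Z : Type*} [TopologicalSpace Z] {F : Z → 𝓜(ℂ, B)} {C : ℝ}
    (hF : ∀ b, Continuous fun z => (F z).fst b) (hC : ∀ z, ‖F z‖ ≤ C) {r : Z → B}
    (hr : Continuous r) : Continuous fun z => (F z).fst (r z) := by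
  refine continuous_iff_continuousAt.2 fun z₀ => ?_
  have h1 : Tendsto (fun z => (F z).fst (r z - r z₀)) (𝓝 z₀) (𝓝 0) := by
    have h2 : Tendsto (fun z => C * ‖r z - r z₀‖) (𝓝 z₀) (𝓝 0) := by
      have : Tendsto (fun z => C * ‖r z - r z₀‖) (𝓝 z₀) (𝓝 (C * ‖r z₀ - r z₀‖)) :=
        (Continuous.tendsto (by fun_prop) z₀)
      simpa using this
    refine squeeze_zero_norm (fun z => ?_) h2
    refine ((F z).fst.le_opNorm _).trans ?_
    rw [norm_fst]
    exact mul_le_mul_of_nonneg_right (hC z) (norm_nonneg _)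
  have h3 := h1.add ((hF (r z₀)).tendsto z₀)
  rw [zero_add] at h3
  refine h3.congr fun z => ?_
  rw [map_sub, sub_add_cancel]

theorem continuous_cfcₙ_invSqrtSubOne {Z : Type*} [TopologicalSpace Z] {w : Z → B}
    (hw : Continuous w) (hws : ∀ z, IsSelfAdjoint (w z)) (hwn : ∀ z, ‖w z‖ ≤ 3 / 4) :
    Continuous fun z => cfcₙ (invSqrtSubOne (1 / 4)) (w z) := by
  refine hw.cfcₙ' (s := Icc (-(3 / 4)) (3 / 4)) isCompact_Icc _ (fun z x hx => ?_)
    (continuous_invSqrtSubOne (by norm_num)).continuousOn (invSqrtSubOne_zero (by norm_num)) hws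
  have :=
    (NonUnitalIsometricContinuousFunctionalCalculus.norm_quasispectrum_le (w z) hx (hws z)).trans
      (hwn z)
  exact abs_le.1 this

/-- For `x = 2G - 1`, passing to `x (1 + w)^(-1/2)` changes `x` by `x r` with `r = (1 + w)^(-1/2) -
1`, which is `B`-valued, continuous and vanishes at infinity with `w`. The bound `3/4` leaves `1 + w
≥ 1/4`. -/
theorem HasProjectionPerturbation.of_norm_le {G : Y → 𝓜(ℂ, B)} {S : Set Y} {C : ℝ}
    (hG : ∀ b, Continuous fun t => (G t).fst b) (hC : ∀ t, ‖G t‖ ≤ C)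
    (hs : ∀ t, IsSelfAdjoint (G t)) (w : C₀(S, B))
    (hw : ∀ t : S, ((w t : B) : 𝓜(ℂ, B)) = (G t + G t - 1) * (G t + G t - 1) - 1)
    (hwn : ∀ t, ‖w t‖ ≤ 3 / 4) : HasProjectionPerturbation G S := by
  have hxs : ∀ t : S, IsSelfAdjoint (G t + G t - 1) := fun t =>
    ((hs t).add (hs t)).sub (IsSelfAdjoint.one _)
  have hws : ∀ t, IsSelfAdjoint (w t) := fun t => by
    rw [← isSelfAdjoint_coe, hw, IsSelfAdjoint, star_sub, star_mul, (hxs t).star_eq, star_one]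
  set r : S → B := fun t => cfcₙ (invSqrtSubOne (1 / 4)) (w t)
  have hr : Continuous r := continuous_cfcₙ_invSqrtSubOne (map_continuous w) hws hwn
  have hr0 : Tendsto r (cocompact S) (𝓝 0) := by
    -- The calculus is continuous on this whole set of self-adjoint elements and is 0 at 0, so it
    -- preserves limits 0 along the cocompact filter.
    let w' : {b : B // IsSelfAdjoint b ∧ ‖b‖ ≤ 3 / 4} → B := fun b => b
    have hc := continuous_cfcₙ_invSqrtSubOne (w := w') continuous_subtype_val (fun z => z.2.1)
      (fun z => z.2.2)
    have h0 : Tendsto (fun t => (⟨w t, hws t, hwn t⟩ : {b : B // IsSelfAdjoint b ∧ ‖b‖ ≤ 3 / 4}))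
        (cocompact S) (𝓝 ⟨0, IsSelfAdjoint.zero _, by norm_num⟩) :=
      tendsto_subtype_rng.2 (zero_at_infty w)
    have h1 := (hc.tendsto _).comp h0
    rw [show cfcₙ (invSqrtSubOne (1 / 4)) (w' ⟨0, IsSelfAdjoint.zero _, by norm_num⟩) = 0 from
      cfcₙ_apply_zero ..] at h1
    exact h1
  have hX : ∀ b, Continuous fun t : S => (G t + G t - 1 : 𝓜(ℂ, B)).fst b := fun b => by
    have := (hG b).comp (continuous_subtype_val (p := (· ∈ S)))
    exact (this.add this).sub continuous_const
  have hXC : ∀ t : S, ‖(G t + G t - 1 : 𝓜(ℂ, B))‖ ≤ C + C + ‖(1 : 𝓜(ℂ, B))‖ := fun t =>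
    (norm_sub_le _ _).trans (add_le_add_left ((norm_add_le _ _).trans (add_le_add (hC t) (hC t))) _)
  let d : C₀(S, B) := ⟨⟨fun t => -((1 / 2 : ℂ) • (G t + G t - 1 : 𝓜(ℂ, B)).fst (r t)),
    ((continuous_fst_apply hX hXC hr).const_smul _).neg⟩, by
    have h0 : Tendsto (fun t : S => (G t + G t - 1 : 𝓜(ℂ, B)).fst (r t)) (cocompact S) (𝓝 0) := by
      have h2 : Tendsto (fun t => (C + C + ‖(1 : 𝓜(ℂ, B))‖) * ‖r t‖) (cocompact S) (𝓝 0) := by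
        simpa using hr0.norm.const_mul (C + C + ‖(1 : 𝓜(ℂ, B))‖)
      refine squeeze_zero_norm (fun t => ?_) h2
      refine (ContinuousLinearMap.le_opNorm _ _).trans ?_
      rw [norm_fst]
      exact mul_le_mul_of_nonneg_right (hXC t) (norm_nonneg _)
    simpa using (h0.const_smul (1 / 2 : ℂ)).neg⟩
  refine ⟨d, fun t => ?_⟩
  have hd : d t = -((1 / 2 : ℂ) • (G t + G t - 1 : 𝓜(ℂ, B)).fst (r t)) := rfl
  have hp := isStarProjection_symmetry (δ := 1 / 4) (by norm_num) (by norm_num) (hxs t) (hw t)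
    fun s hs => by
      have h1 : |s| ≤ 3 / 4 :=
        (IsometricContinuousFunctionalCalculus.norm_spectrum_le _ hs
          (isSelfAdjoint_coe.2 (hws t))).trans ((norm_coe (w t)).trans_le (hwn t))
      rw [mem_Ici]
      linarith [(abs_le.1 h1).1]
  convert hp using 1
  rw [hd, coe_neg, coe_smul, ← mul_coe, mul_add, mul_one, sub_neg_eq_add, ← add_assoc, smul_add]
  congr 1
  rw [add_sub_cancel, smul_add, ← add_smul]
  norm_num

/-- Compactness of `S` puts the constant function `b` in `C₀(S, B)`. -/
theorem HasProjectionPerturbation.of_sub_const {G : Y → 𝓜(ℂ, B)} {S : Set Y} (hS : IsCompact S)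
    {b : B} (h : HasProjectionPerturbation (fun t => G t - (b : 𝓜(ℂ, B))) S) :
    HasProjectionPerturbation G S := by
  obtain ⟨d, hd⟩ := h
  have := isCompact_iff_compactSpace.1 hS
  refine ⟨⟨⟨fun t => b + d t, by fun_prop⟩, by simp⟩, fun t => ?_⟩
  convert hd t using 1
  change G t - ((b + d t : B) : 𝓜(ℂ, B)) = _
  rw [coe_add, sub_add_eq_sub_sub]

theorem add_self_sub_one_mul_self_sub_one {R : Type*} [Ring R] (g : R) :
    (g + g - 1) * (g + g - 1) - 1 = (4 : ℕ) • (g * g - g) := by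
  noncomm_ring

/-- Serves near infinity, where `G` needs no constant correction. Since `(2G - 1)² - 1 = 4(G² - G)`,
the bound is a quarter of `3/4`. -/
theorem HasProjectionPerturbation.of_forall_norm_le {G : Y → 𝓜(ℂ, B)} {S : Set Y} {C : ℝ}
    (hG : ∀ b, Continuous fun t => (G t).fst b) (hC : ∀ t, ‖G t‖ ≤ C)
    (hs : ∀ t, IsSelfAdjoint (G t)) (e : C₀(Y, B))
    (he : ∀ t, ((e t : B) : 𝓜(ℂ, B)) = G t * G t - G t) (hS : IsClosed S)
    (hn : ∀ t ∈ S, ‖e t‖ ≤ 3 / 16) : HasProjectionPerturbation G S := by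
  let e' : C₀(S, B) := e.comp ⟨⟨Subtype.val, continuous_subtype_val⟩,
    hS.isClosedEmbedding_subtypeVal.tendsto_cocompact⟩
  have h4 : ∀ t, ((4 : ℂ) • e') t = (4 : ℂ) • e t := fun _ => rfl
  refine .of_norm_le hG hC hs ((4 : ℂ) • e') (fun t => ?_) fun t => ?_
  · rw [add_self_sub_one_mul_self_sub_one, ← he, h4, coe_smul, ← Nat.cast_smul_eq_nsmul ℂ]
    norm_num
  · rw [h4, norm_smul]
    have := hn t t.2
    norm_num
    linarith

/-- Subtracting a `b` from `B` that makes `G t₀ - b` a projection leaves a defect that is zero at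
`t₀` and norm continuous, hence below `3/4` on a compact neighbourhood. -/
theorem HasProjectionPerturbation.exists_mem_nhds [T2Space Y] [LocallyCompactSpace Y]
    (hM : HasRealRankZero 𝓜(ℂ, B)) {G : Y → 𝓜(ℂ, B)} {C : ℝ}
    (hG : ∀ b, Continuous (fun t => (G t).fst b) ∧ Continuous fun t => (G t).snd b)
    (hC : ∀ t, ‖G t‖ ≤ C) (hs : ∀ t, IsSelfAdjoint (G t)) (e : C₀(Y, B))
    (he : ∀ t, ((e t : B) : 𝓜(ℂ, B)) = G t * G t - G t) (t₀ : Y) :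
    ∃ U ∈ 𝓝 t₀, ∀ S ⊆ U, IsClosed S → HasProjectionPerturbation G S := by
  obtain ⟨b, hb⟩ := hM.exists_isStarProjection_sub (hs t₀)
    ((mem_multiplierIdeal B).2 ⟨e t₀, he t₀⟩)
  have hbs : IsSelfAdjoint (b : 𝓜(ℂ, B)) := by
    have := (hs t₀).sub hb.isSelfAdjoint
    rwa [sub_sub_cancel] at this
  -- This is `4((G - b)² - (G - b))` with `G² - G` replaced by `e`. The remaining terms `G b` and `b
  -- G` are norm continuous by strict continuity of `G` on both sides.
  let w : Y → B := fun t => (4 : ℂ) • (e t - (G t).fst b - (G t).snd b + b * b + b)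
  have hwc : Continuous w := by
    have h1 := (hG b).1
    have h2 := (hG b).2
    fun_prop
  have hw : ∀ t, ((w t : B) : 𝓜(ℂ, B))
      = (4 : ℕ) • ((G t - (b : 𝓜(ℂ, B))) * (G t - (b : 𝓜(ℂ, B))) - (G t - (b : 𝓜(ℂ, B)))) := by
    intro t
    rw [coe_smul, coe_add, coe_add, coe_sub, coe_sub, he, ← mul_coe, ← DoubleCentralizer.coe_mul,
      DoubleCentralizer.coe_mul_coe,
      ← Nat.cast_smul_eq_nsmul ℂ]
    push_cast
    congr 1
    noncomm_ring
  have hw0 : w t₀ = 0 := by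
    refine coe_injective ?_
    change ((w t₀ : B) : 𝓜(ℂ, B)) = ((0 : B) : 𝓜(ℂ, B))
    rw [hw, hb.isIdempotentElem.eq, sub_self, smul_zero, coe_zero]
  have hnhds : {t | ‖w t‖ < 3 / 4} ∈ 𝓝 t₀ :=
    (isOpen_lt hwc.norm continuous_const).mem_nhds (by simp [hw0])
  obtain ⟨K, hK, hKsub, hKc⟩ := local_compact_nhds hnhds
  refine ⟨K, hK, fun S hSK hS => HasProjectionPerturbation.mono ?_ hS hSK⟩
  refine .of_sub_const hKc (b := b) ?_
  have := isCompact_iff_compactSpace.1 hKc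
  refine .of_norm_le (C := C + ‖b‖) (fun b' => ?_) (fun t => ?_) (fun t => (hs t).sub hbs)
    ⟨⟨fun t => w t, hwc.comp continuous_subtype_val⟩, by simp⟩ (fun t => ?_) (fun t => (hKsub t.2).le)
  · exact (hG b').1.sub continuous_const
  · exact (norm_sub_le _ _).trans (add_le_add (hC t) (norm_coe b).le)
  · rw [add_self_sub_one_mul_self_sub_one]
    exact hw t

end Perturbation

/-! ### Self-adjoint lifts of corona projections -/

section Lift

variable {A : Type*} [NonUnitalCStarAlgebra A]

theorem IsStarProjection.exists_isSelfAdjoint_lift {z : Corona A} (hz : IsStarProjection z) :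
    ∃ m : 𝓜(ℂ, A), IsSelfAdjoint m ∧ toCorona m = z ∧ ∃ e : A, (e : 𝓜(ℂ, A)) = m * m - m := by
  obtain ⟨m, rfl⟩ := toCorona_surjective z
  have h1 : toCorona m = toCorona (star m) := by rw [toCorona_star, hz.isSelfAdjoint.star_eq]
  obtain ⟨a, ha⟩ := toCorona_eq_iff.1 h1
  have h2 : toCorona ((1 / 2 : ℂ) • (m + star m)) = toCorona m := by
    refine toCorona_eq_iff.2 ⟨(-(1 / 2) : ℂ) • a, ?_⟩
    have hm : m = (1 / 2 : ℂ) • m + (1 / 2 : ℂ) • m := by rw [← add_smul]; norm_num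
    rw [coe_smul, ha, smul_sub, smul_add]
    nth_rw 5 [hm]
    rw [neg_smul, neg_smul]
    abel
  refine ⟨(1 / 2 : ℂ) • (m + star m), ?_, h2, ?_⟩
  · rw [IsSelfAdjoint, star_smul, star_add, star_star, add_comm]
    norm_num
  · refine toCorona_eq_iff.1 ?_
    rw [map_mul, h2]
    exact hz.isIdempotentElem.eq

end Lift

/-! ### Vanishing at infinity under finite covers and quotients -/

section Gluing

variable {E : Type*} [TopologicalSpace E] [Zero E] {Y : Type*} [TopologicalSpace Y]

theorem tendsto_cocompact_of_finite_cover {ι : Type*} [Finite ι] {S : ι → Set Y}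
    (hS : ∀ t, ∃ i, t ∈ S i) {D : Y → E}
    (hD : ∀ i, Tendsto (fun t : S i => D t) (cocompact (S i)) (𝓝 0)) :
    Tendsto D (cocompact Y) (𝓝 0) := by
  intro V hV
  choose K hK hKV using fun i => mem_cocompact.1 (hD i hV)
  refine mem_cocompact.2 ⟨⋃ i, Subtype.val '' K i, isCompact_iUnion fun i =>
    (hK i).image continuous_subtype_val, fun t ht => ?_⟩
  obtain ⟨i, hi⟩ := hS t
  refine hKV i (a := ⟨t, hi⟩) fun h => ht (mem_iUnion.2 ⟨i, ⟨t, hi⟩, h, rfl⟩)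

theorem tendsto_cocompact_of_comp {X : Type*} [TopologicalSpace X] {q : Y → X} (hq : Continuous q)
    (hqs : Function.Surjective q) {D : X → E} (hD : Tendsto (D ∘ q) (cocompact Y) (𝓝 0)) :
    Tendsto D (cocompact X) (𝓝 0) := by
  intro V hV
  obtain ⟨K, hK, hKV⟩ := mem_cocompact.1 (hD hV)
  refine mem_cocompact.2 ⟨q '' K, hK.image hq, fun x hx => ?_⟩
  obtain ⟨t, rfl⟩ := hqs x
  exact hKV fun h => hx ⟨t, h, rfl⟩

end Gluing

/-! ### The closed pieces of a partition -/

section Pieces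

variable {J : Set ℝ} {n : ℕ} {x : Fin n → J}

theorem isClosed_piece (x : Fin n → J) (i : Fin (n + 1)) : IsClosed (piece x i) := by
  have : piece x i = ⋂ j : Fin n, {t | (j : ℕ) < i → x j ≤ t} ∩ {t | (i : ℕ) ≤ j → t ≤ x j} := by
    ext t
    simp only [piece, mem_iInter, mem_inter_iff, mem_ofPred_eq]
  rw [this]
  refine isClosed_iInter fun j => IsClosed.inter ?_ ?_
  · by_cases h : (j : ℕ) < i
    · simpa [h] using isClosed_le (continuous_const (y := x j)) continuous_id
    · simp [h]
  · by_cases h : (i : ℕ) ≤ j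
    · simpa [h] using isClosed_le continuous_id (continuous_const (y := x j))
    · simp [h]

theorem exists_mem_piece (hx : StrictMono x) (t : J) : ∃ i, t ∈ piece x i := by
  by_cases h : {j | t ≤ x j}.Nonempty
  · obtain ⟨j, hj, hmin⟩ := (wellFounded_lt (α := Fin n)).has_min _ h
    refine ⟨j.castSucc, fun k => ⟨fun hk => ?_, fun hk => ?_⟩⟩
    · exact le_of_not_ge fun h' => hmin k h' hk
    · exact le_trans hj (hx.monotone hk)
  · refine ⟨Fin.last n, fun k => ⟨fun _ => le_of_not_ge fun h' => h ⟨k, h'⟩, fun hk => ?_⟩⟩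
    exact absurd k.2 (not_lt.2 hk)

theorem mem_piece_castSucc (hx : StrictMono x) (j : Fin n) : x j ∈ piece x j.castSucc :=
  fun _ => ⟨fun hk => hx.monotone (le_of_lt hk), fun hk => hx.monotone hk⟩

theorem mem_piece_succ (hx : StrictMono x) (j : Fin n) : x j ∈ piece x j.succ :=
  fun k => ⟨fun hk => hx.monotone (Nat.lt_succ_iff.1 (by simpa using hk)),
    fun hk => hx.monotone (Nat.le_of_succ_le (by simpa using hk))⟩

end Pieces

/-! ### Partitioning the interval and assembling the family -/

namespace PiecewiseFamily

variable {B : Type*} [NonUnitalCStarAlgebra B] {J : Set ℝ} {X : Type*} [TopologicalSpace X]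

/-- One lift decides the whole coset: elements of `C₀(X, B)` pull back and restrict to the pieces.
Conversely, the differences `d' i - d i` all come from `F - F₀`, so they glue. -/
theorem represents_of_sub_mem {q : J → X} (hq : IsQuotientMap q)
    (hqp : Tendsto q (cocompact J) (cocompact X)) {m₀ : 𝓜(ℂ, C₀(X, B))} {F₀ : X → 𝓜(ℂ, B)}
    (h₀ : IsFunctionOf m₀ F₀) (P : PiecewiseFamily B J)
    (hP : ∀ i, ∃ d : C₀(piece P.x i, B), ∀ t : piece P.x i,
      ((d t : B) : 𝓜(ℂ, B)) = F₀ (q t) - P.f i t) :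
    P.Represents q (toCorona m₀) := by
  choose d hd using hP
  intro m
  rw [toCorona_eq_iff]
  constructor
  · rintro ⟨a, ha⟩
    refine ⟨fun x => F₀ x + ((a x : B) : 𝓜(ℂ, B)), fun g x => ?_, fun i => ?_⟩
    · have hm : m = m₀ + (a : 𝓜(ℂ, C₀(X, B))) := by rw [ha]; abel
      rw [hm]
      constructor
      · rw [add_fst, add_fst, add_apply, ZeroAtInftyContinuousMap.add_apply, (h₀ g x).1,
          (IsFunctionOf.coe a g x).1, add_apply]
      · rw [add_snd, add_snd, add_apply, ZeroAtInftyContinuousMap.add_apply, (h₀ g x).2,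
          (IsFunctionOf.coe a g x).2, add_apply]
    · let a' : C₀(piece P.x i, B) := a.comp ⟨⟨fun t => q t, hq.continuous.comp continuous_subtype_val⟩,
        hqp.comp (isClosed_piece P.x i).isClosedEmbedding_subtypeVal.tendsto_cocompact⟩
      refine ⟨d i + a', fun t => ?_⟩
      rw [ZeroAtInftyContinuousMap.add_apply, coe_add, hd]
      exact sub_add_eq_add_sub _ _ _
  · rintro ⟨F, hF, hFd⟩
    choose d' hd' using hFd
    have hdiff : ∀ i, ∀ t : piece P.x i,
        (((d' i - d i) t : B) : 𝓜(ℂ, B)) = F (q t) - F₀ (q t) := fun i t => by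
      rw [ZeroAtInftyContinuousMap.sub_apply, coe_sub, hd, hd']
      abel
    -- The difference is defined on `X` rather than on `J`, so compatibility with the
    -- identifications made by `q` is automatic.
    have hD : ∀ x, ∃ b : B, (b : 𝓜(ℂ, B)) = F x - F₀ x := fun x => by
      obtain ⟨t, rfl⟩ := hq.surjective x
      obtain ⟨i, hi⟩ := exists_mem_piece P.strictMono_x t
      exact ⟨_, hdiff i ⟨t, hi⟩⟩
    choose D hD using hD
    have hDi : ∀ i, (fun t : piece P.x i => D (q t)) = d' i - d i := fun i => by
      ext t
      refine coe_injective ?_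
      change ((D (q t) : B) : 𝓜(ℂ, B)) = (((d' i - d i) t : B) : 𝓜(ℂ, B))
      rw [hD, hdiff]
    have hcov := exists_mem_piece P.strictMono_x
    have hcont : Continuous (D ∘ q) := by
      refine (locallyFinite_of_finite fun i => piece P.x i).continuous
        (eq_univ_of_forall fun t => mem_iUnion.2 (hcov t)) (isClosed_piece P.x) fun i => ?_
      rw [continuousOn_iff_continuous_domRestrict]
      change Continuous fun t : piece P.x i => D (q t)
      rw [hDi]
      exact map_continuous (d' i - d i)
    have hzero : Tendsto (D ∘ q) (cocompact J) (𝓝 0) := by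
      refine tendsto_cocompact_of_finite_cover hcov fun i => ?_
      change Tendsto (fun t : piece P.x i => D (q t)) _ _
      rw [hDi]
      exact zero_at_infty (d' i - d i)
    let a : C₀(X, B) := ⟨⟨D, hq.continuous_iff.2 hcont⟩,
      tendsto_cocompact_of_comp hq.continuous hq.surjective hzero⟩
    exact ⟨a, (IsFunctionOf.coe a).eq_of_forall (hF.sub h₀) hD⟩

theorem exists_of_hasProjectionPerturbation {G : J → 𝓜(ℂ, B)}
    (hG : ∀ b, Continuous (fun t => (G t).fst b) ∧ Continuous fun t => (G t).snd b) {n : ℕ}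
    {x : Fin n → J} (hx : StrictMono x) (hxi : ∀ j, (x j : ℝ) ∈ interior J)
    (h : ∀ i, HasProjectionPerturbation G (piece x i)) :
    ∃ P : PiecewiseFamily B J, P.IsProjectionValued ∧
      ∀ i, ∃ d : C₀(piece P.x i, B), ∀ t : piece P.x i,
        ((d t : B) : 𝓜(ℂ, B)) = G t - P.f i t := by
  classical
  choose d hd using h
  let f : Fin (n + 1) → J → 𝓜(ℂ, B) := fun i t =>
    if ht : t ∈ piece x i then G t - ((d i ⟨t, ht⟩ : B) : 𝓜(ℂ, B)) else 0
  have hf : ∀ i, ∀ t (ht : t ∈ piece x i), f i t = G t - ((d i ⟨t, ht⟩ : B) : 𝓜(ℂ, B)) :=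
    fun i t ht => dif_pos ht
  refine ⟨⟨n, x, hx, hxi, f, fun i => ⟨?_, 1, fun t ht => ?_⟩, fun j => ?_⟩, fun i t ht => ?_,
    fun i => ⟨d i, fun t => ?_⟩⟩
  · refine continuousOn_strictTopology.2 fun b => ⟨?_, ?_⟩
    · rw [continuousOn_iff_continuous_domRestrict]
      have : (piece x i).domRestrict (fun t => (f i t).fst b)
          = fun t : piece x i => (G t).fst b - d i t * b := by
        ext t
        rw [domRestrict_apply, hf i t t.2, sub_fst, sub_apply, coe_fst]
        rfl
      rw [this]
      exact ((hG b).1.comp continuous_subtype_val).sub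
        ((map_continuous (d i)).mul continuous_const)
    · rw [continuousOn_iff_continuous_domRestrict]
      have : (piece x i).domRestrict (fun t => (f i t).snd b)
          = fun t : piece x i => (G t).snd b - b * d i t := by
        ext t
        rw [domRestrict_apply, hf i t t.2, sub_snd, sub_apply, coe_snd]
        rfl
      rw [this]
      exact ((hG b).2.comp continuous_subtype_val).sub
        (continuous_const.mul (map_continuous (d i)))
  · rw [hf i t ht]
    exact (hd i ⟨t, ht⟩).norm_le
  · refine ⟨d j.castSucc ⟨x j, mem_piece_castSucc hx j⟩ - d j.succ ⟨x j, mem_piece_succ hx j⟩, ?_⟩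
    rw [hf _ _ (mem_piece_castSucc hx j), hf _ _ (mem_piece_succ hx j), coe_sub]
    abel
  · change IsStarProjection (f i t)
    rw [hf i t ht]
    exact hd i ⟨t, ht⟩
  · change _ = G t - f i t
    rw [hf i t t.2, sub_sub_cancel]

/-- A partition of `J` into two end pieces `{t ≤ a}`, `{b ≤ t}` and short pieces of `[a, b]`. -/
theorem exists_partition (hJ : IsClosed J) (hJc : Convex ℝ J) {p : Set J → Prop}
    (hmono : ∀ S S', p S → IsClosed S' → S' ⊆ S → p S')
    (hloc : ∀ t : J, ∃ U ∈ 𝓝 t, ∀ S ⊆ U, IsClosed S → p S) {a b : ℝ} (hab : a < b)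
    (ha : a ∈ interior J) (hb : b ∈ interior J) (hpa : p {t | (t : ℝ) ≤ a})
    (hpb : p {t | b ≤ (t : ℝ)}) :
    ∃ (n : ℕ) (x : Fin n → J), StrictMono x ∧ (∀ j, (x j : ℝ) ∈ interior J) ∧
      ∀ i, p (piece x i) := by
  choose U hU hUp using hloc
  have hK : IsCompact {t : J | (t : ℝ) ∈ Icc a b} :=
    hJ.isClosedEmbedding_subtypeVal.isCompact_preimage isCompact_Icc
  obtain ⟨δ, hδ, hball⟩ := lebesgue_number_lemma_of_metric hK (c := fun t => interior (U t))
    (fun t => isOpen_interior)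
    (fun t _ => mem_iUnion.2 ⟨t, mem_interior_iff_mem_nhds.2 (hU t)⟩)
  obtain ⟨N, hN⟩ := exists_nat_gt ((b - a) / δ)
  have hN0 : (0 : ℝ) < N := (div_pos (sub_pos.2 hab) hδ).trans hN
  have hstep : (b - a) / N < δ := by
    rw [div_lt_iff₀ hδ] at hN
    rw [div_lt_iff₀ hN0]
    linarith
  have hpos : 0 < (b - a) / N := div_pos (sub_pos.2 hab) hN0
  have hNb : a + N * ((b - a) / N) = b := by field_simp; ring
  have hmem : ∀ j : Fin (N + 1), a + j * ((b - a) / N) ∈ Icc a b := fun j => by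
    have hj : ((j : ℕ) : ℝ) ≤ N := by exact_mod_cast Nat.lt_succ_iff.1 j.2
    have h1 := mul_le_mul_of_nonneg_right hj hpos.le
    have h2 : 0 ≤ ((j : ℕ) : ℝ) * ((b - a) / N) := by positivity
    exact ⟨by linarith, by linarith⟩
  have hint : ∀ j : Fin (N + 1), a + j * ((b - a) / N) ∈ interior J := fun j =>
    hJc.interior.ordConnected.out ha hb (hmem j)
  -- Both `a` and `b` are partition points: pieces `0` and `N + 1` are the two ends, and the `N`
  -- pieces between have length `(b - a) / N < δ`.
  let x : Fin (N + 1) → J := fun j => ⟨a + j * ((b - a) / N), interior_subset (hint j)⟩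
  have hxv : ∀ j, (x j : ℝ) = a + j * ((b - a) / N) := fun _ => rfl
  refine ⟨N + 1, x, fun j k hjk => ?_, hint, fun i => ?_⟩
  · have : ((j : ℕ) : ℝ) < (k : ℕ) := by exact_mod_cast hjk
    rw [← Subtype.coe_lt_coe, hxv, hxv]
    linarith [mul_lt_mul_of_pos_right this hpos]
  · rcases Nat.eq_zero_or_pos (i : ℕ) with hi | hi
    · refine hmono _ _ hpa (isClosed_piece x i) fun t ht => ?_
      have h1 := (ht 0).2 (by simp [hi])
      rw [← Subtype.coe_le_coe, hxv] at h1
      simpa using h1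
    · rcases Nat.lt_or_ge (i : ℕ) (N + 1) with hiN | hiN
      · let k : Fin (N + 1) := ⟨(i : ℕ) - 1, by omega⟩
        have hk : ((k : ℕ) : ℝ) + 1 = (i : ℕ) := by
          have : (k : ℕ) + 1 = i := Nat.sub_add_cancel hi
          exact_mod_cast this
        obtain ⟨t₀, ht₀⟩ := hball (x k) (hmem k)
        refine hUp t₀ _ (fun t ht => interior_subset (ht₀ ?_)) (isClosed_piece x i)
        have h1 := (ht k).1 (Nat.sub_lt hi one_pos)
        have h2 := (ht ⟨i, hiN⟩).2 le_rfl
        rw [← Subtype.coe_le_coe, hxv] at h1 h2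
        rw [Metric.mem_ball, Subtype.dist_eq, Real.dist_eq, abs_lt, hxv]
        rw [← hk] at h2
        constructor <;> linarith
      · refine hmono _ _ hpb (isClosed_piece x i) fun t ht => ?_
        have h1 := (ht (Fin.last N)).1 hiN
        rw [← Subtype.coe_le_coe, hxv, Fin.val_last, hNb] at h1
        exact h1

theorem exists_bound_of_zeroAtInfty (e : C₀(J, B)) {ε : ℝ} (hε : 0 < ε) :
    ∃ R : ℝ, ∀ t : J, R < |(t : ℝ)| → ‖e t‖ ≤ ε := by
  obtain ⟨K, hK, hKe⟩ := mem_cocompact.1 (zero_at_infty e (Metric.ball_mem_nhds 0 hε))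
  obtain ⟨R, hR⟩ := (hK.image continuous_subtype_val).isBounded.exists_norm_le
  refine ⟨R, fun t ht => ?_⟩
  have h1 : t ∈ Kᶜ := fun h => absurd (hR t ⟨t, h, rfl⟩) (not_le.2 ht)
  have h2 := hKe h1
  rw [mem_preimage, mem_ball_zero_iff] at h2
  exact h2.le

/-- The common function `F₀` is returned as well, because comparing the two ends of the circle
requires it. -/
theorem exists_represents (hM : HasRealRankZero 𝓜(ℂ, B))
    (hJ : J = Icc 0 1 ∨ J = Ici 0 ∨ J = univ) [T2Space X] [LocallyCompactSpace X] {q : J → X}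
    (hq : IsQuotientMap q) (hqp : Tendsto q (cocompact J) (cocompact X)) {z : Corona C₀(X, B)}
    (hz : IsStarProjection z) :
    ∃ (P : PiecewiseFamily B J) (F₀ : X → 𝓜(ℂ, B)), P.Represents q z ∧ P.IsProjectionValued ∧
      ∀ i, ∃ d : C₀(piece P.x i, B), ∀ t : piece P.x i,
        ((d t : B) : 𝓜(ℂ, B)) = F₀ (q t) - P.f i t := by
  obtain ⟨m₀, hm₀, rfl, e₀, he₀⟩ := hz.exists_isSelfAdjoint_lift
  obtain ⟨F₀, hF₀, hbd⟩ := exists_isFunctionOf m₀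
  have hJcl : IsClosed J := by
    rcases hJ with rfl | rfl | rfl
    exacts [isClosed_Icc, isClosed_Ici, isClosed_univ]
  have hJc : Convex ℝ J := by
    rcases hJ with rfl | rfl | rfl
    exacts [convex_Icc _ _, convex_Ici _, convex_univ]
  have : LocallyCompactSpace J := hJcl.isClosedEmbedding_subtypeVal.locallyCompactSpace
  let G : J → 𝓜(ℂ, B) := F₀ ∘ q
  have hG : ∀ b, Continuous (fun t => (G t).fst b) ∧ Continuous fun t => (G t).snd b := fun b =>
    ⟨(hF₀.continuous b).1.comp hq.continuous, (hF₀.continuous b).2.comp hq.continuous⟩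
  have hC : ∀ t, ‖G t‖ ≤ ‖m₀‖ := fun t => hbd (q t)
  have hs : ∀ t, IsSelfAdjoint (G t) := fun t => hF₀.isSelfAdjoint hm₀ (q t)
  let e : C₀(J, B) := e₀.comp ⟨⟨q, hq.continuous⟩, hqp⟩
  have he : ∀ t, ((e t : B) : 𝓜(ℂ, B)) = G t * G t - G t := fun t => by
    have h := (hF₀.mul hF₀).sub hF₀
    rw [← he₀] at h
    exact (IsFunctionOf.coe e₀).unique h (q t)
  have hloc : ∀ t : J, ∃ U ∈ 𝓝 t, ∀ S ⊆ U, IsClosed S → HasProjectionPerturbation G S :=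
    HasProjectionPerturbation.exists_mem_nhds hM hG hC hs e he
  have hmono : ∀ S S', HasProjectionPerturbation G S → IsClosed S' → S' ⊆ S →
      HasProjectionPerturbation G S' := fun S S' h => h.mono
  obtain ⟨R, hR⟩ := exists_bound_of_zeroAtInfty e (ε := 3 / 16) (by norm_num)
  have hfar : ∀ S : Set J, IsClosed S → (∀ t ∈ S, R < |(t : ℝ)|) → HasProjectionPerturbation G S :=
    fun S hS h => .of_forall_norm_le (fun b => (hG b).1) hC hs e he hS fun t ht => hR t (h t ht)
  -- A finite end point is handled by the local perturbation, an infinite one by smallness of `e`.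
  -- The value `1/2` merely separates the left cut from the right one.
  have hleft : ∃ a < 1 / 2, a ∈ interior J ∧ HasProjectionPerturbation G {t | (t : ℝ) ≤ a} := by
    have hfin : (h0 : (0 : ℝ) ∈ J) → (∀ t ∈ J, 0 ≤ t) →
        ∃ a > 0, a < 1 / 2 ∧ HasProjectionPerturbation G {t | (t : ℝ) ≤ a} := by
      intro h0 hJ0
      obtain ⟨U, hU, hUS⟩ := hloc ⟨0, h0⟩
      obtain ⟨ε, hε, hεU⟩ := Metric.mem_nhds_iff.1 hU
      refine ⟨min (ε / 2) (1 / 4), by positivity, by linarith [min_le_right (ε / 2) (1 / 4)],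
        hUS _ (fun t ht => hεU ?_) (isClosed_le continuous_subtype_val continuous_const)⟩
      have ht' : (t : ℝ) ≤ min (ε / 2) (1 / 4) := ht
      have h1 := hJ0 t t.2
      rw [Metric.mem_ball, Subtype.dist_eq, Real.dist_eq, sub_zero, abs_of_nonneg h1]
      linarith [min_le_left (ε / 2) (1 / 4)]
    rcases hJ with rfl | rfl | rfl
    · obtain ⟨a, ha0, ha1, ha⟩ := hfin (by norm_num) fun t ht => ht.1
      exact ⟨a, ha1, by rw [interior_Icc]; exact ⟨ha0, by linarith⟩, ha⟩
    · obtain ⟨a, ha0, ha1, ha⟩ := hfin (mem_Ici.2 le_rfl) fun t ht => ht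
      exact ⟨a, ha1, by rw [interior_Ici]; exact ha0, ha⟩
    · refine ⟨-(|R| + 1), by linarith [abs_nonneg R], by simp, hfar _
        (isClosed_le continuous_subtype_val continuous_const) fun t ht => ?_⟩
      have ht' : (t : ℝ) ≤ -(|R| + 1) := ht
      linarith [le_abs_self R, neg_le_abs (t : ℝ)]
  have hright : ∃ b > 1 / 2, b ∈ interior J ∧ HasProjectionPerturbation G {t | b ≤ (t : ℝ)} := by
    have hinf : HasProjectionPerturbation G {t | |R| + 1 ≤ (t : ℝ)} := by
      refine hfar _ (isClosed_le continuous_const continuous_subtype_val) fun t ht => ?_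
      have ht' : |R| + 1 ≤ (t : ℝ) := ht
      linarith [le_abs_self R, le_abs_self (t : ℝ)]
    rcases hJ with rfl | rfl | rfl
    · obtain ⟨U, hU, hUS⟩ := hloc ⟨1, by norm_num⟩
      obtain ⟨ε, hε, hεU⟩ := Metric.mem_nhds_iff.1 hU
      have hm : 0 < min (ε / 2) (1 / 4) := by positivity
      have hm1 := min_le_right (ε / 2) (1 / 4)
      refine ⟨1 - min (ε / 2) (1 / 4), by linarith, ?_,
        hUS _ (fun t ht => hεU ?_) (isClosed_le continuous_const continuous_subtype_val)⟩
      · rw [interior_Icc]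
        constructor <;> linarith
      · have ht' : 1 - min (ε / 2) (1 / 4) ≤ (t : ℝ) := ht
        have h1 := t.2.2
        rw [Metric.mem_ball, Subtype.dist_eq, Real.dist_eq, abs_lt]
        have h2 := min_le_left (ε / 2) (1 / 4)
        constructor <;> simp only <;> linarith
    · exact ⟨|R| + 1, by linarith [abs_nonneg R], by
        rw [interior_Ici]; exact mem_Ioi.2 (by positivity), hinf⟩
    · exact ⟨|R| + 1, by linarith [abs_nonneg R], by simp, hinf⟩
  obtain ⟨a, ha, haJ, hpa⟩ := hleft
  obtain ⟨b, hb, hbJ, hpb⟩ := hright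
  obtain ⟨n, x, hx, hxi, hp⟩ := exists_partition hJcl hJc hmono hloc (ha.trans hb) haJ hbJ hpa hpb
  obtain ⟨P, hPp, hPd⟩ := exists_of_hasProjectionPerturbation hG hx hxi hp
  exact ⟨P, F₀, P.represents_of_sub_mem hq hqp hF₀ hPd, hPp, hPd⟩

end PiecewiseFamily

theorem theorem3p2 {B : Type*} [NonUnitalCStarAlgebra B]
    (hB : IsStableCStarAlgebra B) (hM : HasRealRankZero 𝓜(ℂ, B)) :
    -- `X = [0, 1]`, `X = [0, ∞)` or `X = (-∞, ∞)`
    (∀ J : Set ℝ, J = Set.Icc 0 1 ∨ J = Set.Ici 0 ∨ J = Set.univ →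
      ∀ z : Corona C₀(J, B), IsStarProjection z →
        ∃ P : PiecewiseFamily B J, P.Represents id z ∧ P.IsProjectionValued) ∧
    -- `X = 𝕋 = [0, 1]/{0, 1}`
    (∀ z : Corona C₀(AddCircle (1 : ℝ), B), IsStarProjection z →
      ∃ P : PiecewiseFamily B (Set.Icc (0 : ℝ) 1),
        P.Represents (fun t => ((t : ℝ) : AddCircle (1 : ℝ))) z ∧ P.IsProjectionValued ∧
        ∃ b : B, (b : 𝓜(ℂ, B)) = P.f 0 0 - P.f (Fin.last P.n) 1) := by
  refine ⟨fun J hJ z hz => ?_, fun z hz => ?_⟩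
  · have hJcl : IsClosed J := by
      rcases hJ with rfl | rfl | rfl
      exacts [isClosed_Icc, isClosed_Ici, isClosed_univ]
    have : LocallyCompactSpace J := hJcl.isClosedEmbedding_subtypeVal.locallyCompactSpace
    obtain ⟨P, -, h1, h2, -⟩ :=
      PiecewiseFamily.exists_represents hM hJ (q := id) IsQuotientMap.id tendsto_id hz
    exact ⟨P, h1, h2⟩
  · set q : Icc (0 : ℝ) 1 → AddCircle (1 : ℝ) := fun t => ((t : ℝ) : AddCircle (1 : ℝ)) with hqdef
    have : Fact ((0 : ℝ) < 1) := ⟨one_pos⟩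
    have hqc : Continuous q := (AddCircle.continuous_mk' 1).comp continuous_subtype_val
    have hqs : Function.Surjective q := fun y => by
      obtain ⟨t, ht, rfl⟩ := AddCircle.coe_image_Icc_eq (1 : ℝ) 0 ▸ mem_univ y
      exact ⟨⟨t, by simpa using ht⟩, rfl⟩
    have hq : IsQuotientMap q := hqc.isClosedMap.isQuotientMap hqc hqs
    obtain ⟨P, F₀, h1, h2, h3⟩ := PiecewiseFamily.exists_represents hM (.inl rfl) hq
      (by simp) hz
    refine ⟨P, h1, h2, ?_⟩
    obtain ⟨d, hd⟩ := h3 0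
    obtain ⟨d', hd'⟩ := h3 (Fin.last P.n)
    have m0 : (0 : Icc (0 : ℝ) 1) ∈ piece P.x 0 := fun j =>
      ⟨fun h => absurd h (Nat.not_lt_zero _), fun _ => (P.x j).2.1⟩
    have m1 : (1 : Icc (0 : ℝ) 1) ∈ piece P.x (Fin.last P.n) := fun j =>
      ⟨fun _ => (P.x j).2.2, fun h => absurd j.2 (not_lt.2 h)⟩
    -- Both end values differ by elements of `B` from the same `F₀ (q 0)`, hence from each other.
    have hq01 : q 1 = q 0 := by
      simp [hqdef, AddCircle.coe_period]
    refine ⟨d' ⟨1, m1⟩ - d ⟨0, m0⟩, ?_⟩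
    rw [coe_sub, hd, hd', hq01]
    abel
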